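/- Let $n \ge 1$ and $0 \le d \le n$ be integers with $d$ even, and let $$\sigma_{d,n} = \sum_{I \subseteq \{1,\dots,n\},\ |I| = d}\ \prod_{i \in I} x_i \in \mathbb{C}[x_1,\dots,x_n]$$ be the elementary symmetric polynomial of degree $d$ in $n$ variables. For a form $F \in \mathbb{C}[x_1,\dots,x_n]$ of degree $d$, let $\operatorname{rank}(F)$ denote its symmetric tensor rank, that is, the least integer $s \ge 0$ such that $F = \sum_{i=1}^{s} L_i^d$ for some linear forms $L_1,\dots,L_s \in \mathbb{C}[x_1,\dots,x_n]$. Then $\sigma_{d,n}$ has such a representation as a sum of $d$-th powers of linear forms, and $$\left(\sum_{r=0}^{d/2} \binom{n}{r}\right) - \binom{n-1}{d/2} \;\le\; \operatorname{rank}(\sigma_{d,n}) \;\le\; \sum_{r=0}^{d/2} \binom{n}{r}.$$ -/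

import Mathlib

/-- `F` is a sum of `s` many `d`-th powers of complex linear forms in `x_1, …, x_n`
(homogeneous polynomials of degree one; the zero form is allowed). -/
def IsPowerSum {n : ℕ} (d : ℕ) (F : MvPolynomial (Fin n) ℂ) (s : ℕ) : Prop :=
  ∃ L : Fin s → MvPolynomial (Fin n) ℂ,
    (∀ i, (L i).IsHomogeneous 1) ∧ F = ∑ i, L i ^ d

/-- The symmetric tensor rank of a form `F` of degree `d` in `ℂ[x_1, …, x_n]`: the least `s` such
that `F` is a sum of `s` many `d`-th powers of linear forms. It is meaningful when some such `s`
exists. -/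
noncomputable def symmetricRank {n : ℕ} (d : ℕ) (F : MvPolynomial (Fin n) ℂ) : ℕ :=
  sInf {s : ℕ | IsPowerSum d F s}

/-!
Comparing coefficients, `σ_d = ∑ j, (a_j · x) ^ d` holds if and only if, for every exponent `α` of
degree `d`, the moment `∑ j, a_j ^ α` is `1 / d!` when `α` is square-free and `0` otherwise
(`esymm_eq_sum_pow_iff`). Write `d = 2 * k`.

*Upper bound.* The nodes are the sign vectors `v_I`, with `-1` exactly at the positions in `I`, for
`#I ≤ k`. The monomial `α` takes the value `(-1) ^ #(I ∩ J)` at `v_I`, where `J` is the set of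
positions with odd exponent; `#J` is even, at most `2 * k`, and equal to `2 * k` exactly when `α` is
square-free. So it suffices that a function of `J` which depends only on `#J`, vanishes for
`#J = 0, 2, …, 2 * k - 2` and not for `#J = 2 * k` is a combination of the characters of degree at
most `k`. The product `∏ i < k, (#J - 2 * i)` is one, because `#J` is a combination of characters of
degree at most one (`prod_card_sub_mem_span`).

*Lower bound.* Dividing by the first coordinate turns the moments of the exponents divisible by `x_1`
into a quadrature rule in the other `m = n - 1` variables: it kills all monomials of degree at most
`2 * k - 1`, except the square-free ones of degree exactly `2 * k - 1`. The square-free monomials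
`y^S` with `#S < k`, together with forms `g_S` of degree `2 * k - 1 - #S` dual to them, pair with
each other under this rule in a triangular matrix, so they are linearly independent as functions on
the nodes (`two_mul_card_le_of_moments`). The forms `g_S` exist because the disjointness matrix
between subsets of sizes `j ≤ l` of an `m`-element set has a right inverse when `j + l ≤ m`
(`sum_disjointnessInverse`). Hence there are at least `2 * ∑ r < k, m.choose r` nodes, which is the
stated number.
-/

open Finset MvPolynomial

/-! ### Power sums and moments -/

theorem coeff_esymm_eq_ite {n : ℕ} (d : ℕ) (α : Fin n →₀ ℕ) :
    coeff α (esymm (Fin n) ℂ d) = if ∑ i, α i = d ∧ ∀ i, α i ≤ 1 then 1 else 0 := by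
  have key : ∀ t : Finset (Fin n), (∑ i ∈ t, Finsupp.single i 1 = α) ↔
      ∀ i, α i = if i ∈ t then 1 else 0 := by
    intro t
    rw [Finsupp.ext_iff]
    refine forall_congr' fun i => ?_
    simp [Finsupp.finsetSum_apply, Finsupp.single_apply, eq_comm]
  rw [esymm_eq_sum_monomial, coeff_sum]
  simp only [coeff_monomial, key]
  split_ifs with h
  · obtain ⟨hd, h1⟩ := h
    have hα : ∀ i, α i = if i ∈ α.support then 1 else 0 := by
      intro i
      have := h1 i
      simp only [Finsupp.mem_support_iff]
      split_ifs <;> omega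
    rw [Finset.sum_eq_single α.support, if_pos hα]
    · intro t _ ht
      refine if_neg fun h' => ht ?_
      ext i
      have := h' i
      simp only [Finsupp.mem_support_iff]
      split_ifs at this with hi <;> simp [hi, this]
    · intro ht
      refine absurd ?_ ht
      rw [mem_powersetCard_univ, ← hd, Finset.sum_congr rfl fun i _ => hα i, Finset.sum_ite_mem,
        univ_inter, Finset.card_eq_sum_ones]
  · refine Finset.sum_eq_zero fun t ht => if_neg fun h' => h ⟨?_, ?_⟩
    · rw [Finset.sum_congr rfl fun i _ => h' i]
      simpa using ht
    · intro i
      rw [h' i]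
      split_ifs <;> simp

/-- Comparing coefficients: the multinomial coefficient of a square-free exponent is `d!`, and for
the other exponents it is nonzero and can be cancelled. -/
theorem esymm_eq_sum_pow_iff {ι : Type*} [Fintype ι] {n d : ℕ} (a : ι → Fin n → ℂ) :
    esymm (Fin n) ℂ d = ∑ j, (∑ i, a j i • X i) ^ d ↔
      ∀ α : Fin n →₀ ℕ, ∑ i, α i = d →
        (d.factorial : ℂ) * ∑ j, ∏ i, a j i ^ α i = if ∀ i, α i ≤ 1 then 1 else 0 := by
  rw [MvPolynomial.ext_iff]
  refine forall_congr' fun α => ?_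
  have hsum : (α.sum fun _ m => m) = ∑ i, α i := Finsupp.sum_fintype _ _ fun _ => rfl
  have hprod : ∀ j, (α.prod fun r m => a j r ^ m) = ∏ i, a j i ^ α i := fun j =>
    Finsupp.prod_fintype _ _ fun _ => pow_zero _
  rw [coeff_esymm_eq_ite, coeff_sum]
  simp only [coeff_linearCombination_X_pow_of_fintype, hsum, hprod]
  by_cases hd : ∑ i, α i = d
  · simp only [hd, true_and, if_true, forall_const, ← Finset.mul_sum]
    have hm : α.multinomial = Nat.multinomial univ α :=
      Finsupp.multinomial_eq_of_support_subset (subset_univ _)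
    have hspec := Nat.multinomial_spec univ α
    rw [← hm, hd] at hspec
    split_ifs with h1
    · have : ∏ i, (α i).factorial = 1 :=
        Finset.prod_eq_one fun i _ => Nat.factorial_eq_one.2 (h1 i)
      rw [this, one_mul] at hspec
      rw [hspec, eq_comm]
    · have hne : α.multinomial ≠ 0 := by
        intro h0
        rw [h0, mul_zero] at hspec
        exact d.factorial_ne_zero hspec.symm
      have hne' : (α.multinomial : ℂ) ≠ 0 := Nat.cast_ne_zero.2 hne
      have hd' : (d.factorial : ℂ) ≠ 0 := Nat.cast_ne_zero.2 d.factorial_ne_zero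
      rw [eq_comm, mul_eq_zero, mul_eq_zero, or_iff_right hne', or_iff_right hd']
  · simp [hd]

theorem exists_eq_sum_smul_X {n : ℕ} {L : MvPolynomial (Fin n) ℂ} (hL : L.IsHomogeneous 1) :
    ∃ a : Fin n → ℂ, ∑ i, a i • X i = L := by
  have : L ∈ homogeneousSubmodule (Fin n) ℂ 1 := hL
  rw [homogeneousSubmodule_one_eq_span_X] at this
  exact (Submodule.mem_span_range_iff_exists_fun ℂ).1 this

theorem isHomogeneous_sum_smul_X {n : ℕ} (a : Fin n → ℂ) :
    (∑ i, a i • X i : MvPolynomial (Fin n) ℂ).IsHomogeneous 1 :=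
  IsHomogeneous.sum _ _ _ fun i _ => by
    simpa [smul_eq_C_mul] using isHomogeneous_C_mul_X (a i) i

/-! ### Sign characters and the upper bound -/

/-- The character `J ↦ (-1) ^ #(I ∩ J)` of the group of subsets of `Fin n`. -/
def signChar {n : ℕ} (I J : Finset (Fin n)) : ℂ := ∏ i ∈ J, if i ∈ I then -1 else 1

theorem signChar_singleton_mul {n : ℕ} (i : Fin n) (I J : Finset (Fin n)) :
    signChar {i} J * signChar I J = signChar (symmDiff {i} I) J := by
  simp only [signChar, ← Finset.prod_mul_distrib]
  refine Finset.prod_congr rfl fun x _ => ?_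
  by_cases h1 : x = i <;> by_cases h2 : x ∈ I <;> simp [Finset.mem_symmDiff, h1, h2]

theorem sum_signChar_singleton {n : ℕ} (J : Finset (Fin n)) :
    ∑ i, signChar {i} J = n - 2 * (#J : ℂ) := by
  have h : ∀ i, signChar {i} J = 1 - 2 * if i ∈ J then 1 else 0 := by
    intro i
    simp only [signChar, mem_singleton]
    rw [Finset.prod_ite_eq']
    split_ifs <;> norm_num
  simp [h, mul_comm]

/-- Multiplication by the cardinality `#J = (n - ∑ i, signChar {i} J) / 2` raises the degree in the
characters by at most one. -/
theorem prod_card_sub_mem_span {n : ℕ} (k : ℕ) (z : ℕ → ℂ) :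
    (fun J : Finset (Fin n) => ∏ i ∈ range k, ((#J : ℂ) - z i)) ∈
      Submodule.span ℂ (signChar '' {I : Finset (Fin n) | #I ≤ k}) := by
  induction k with
  | zero =>
    refine Submodule.subset_span ⟨∅, by simp, ?_⟩
    ext J
    simp [signChar]
  | succ k ih =>
    have hmul : ∀ f ∈ Submodule.span ℂ (signChar '' {I : Finset (Fin n) | #I ≤ k}),
        (fun J : Finset (Fin n) => f J * ((#J : ℂ) - z k)) ∈
          Submodule.span ℂ (signChar '' {I : Finset (Fin n) | #I ≤ k + 1}) := by
      intro f hf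
      induction hf using Submodule.span_induction with
      | mem f hf =>
        obtain ⟨I, hI, rfl⟩ := hf
        have heq : (fun J : Finset (Fin n) => signChar I J * ((#J : ℂ) - z k)) =
            ((n : ℂ) / 2 - z k) • signChar I
              - (1 / 2 : ℂ) • ∑ i, signChar (symmDiff {i} I) := by
          ext J
          have hs := sum_signChar_singleton J
          simp only [Pi.sub_apply, Pi.smul_apply, smul_eq_mul, Finset.sum_apply,
            ← signChar_singleton_mul, ← Finset.sum_mul, hs]
          ring
        rw [heq]
        refine Submodule.sub_mem _ (Submodule.smul_mem _ _ (Submodule.subset_span ⟨I, ?_, rfl⟩))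
          (Submodule.smul_mem _ _ (Submodule.sum_mem _ fun i _ =>
            Submodule.subset_span ⟨_, ?_, rfl⟩))
        · exact Nat.le_succ_of_le hI
        · have hsub : symmDiff {i} I ⊆ {i} ∪ I := symmDiff_le_sup
          have h1 := (card_le_card hsub).trans (card_union_le _ _)
          have hI' : #I ≤ k := hI
          simp only [card_singleton] at h1
          simp only [Set.mem_ofPred_eq]
          omega
      | zero =>
        simp only [Pi.zero_apply, zero_mul]
        exact Submodule.zero_mem _
      | add f g _ _ hf hg =>
        convert! Submodule.add_mem _ hf hg using 1
        ext J
        simp [add_mul]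
      | smul c f _ hf =>
        convert! Submodule.smul_mem _ c hf using 1
        ext J
        simp [mul_assoc]
    simpa only [Finset.prod_range_succ] using hmul _ ih

theorem prod_pow_eq_signChar {n : ℕ} (I : Finset (Fin n)) (α : Fin n → ℕ) :
    ∏ i, (if i ∈ I then (-1 : ℂ) else 1) ^ α i = signChar I {i | Odd (α i)} := by
  rw [signChar, Finset.prod_filter]
  refine Finset.prod_congr rfl fun i _ => ?_
  rcases Nat.even_or_odd (α i) with h | h
  · have h' : ¬ Odd (α i) := by simpa using h
    split_ifs <;> simp [h.neg_one_pow]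
  · split_ifs <;> simp [h.neg_one_pow]

/-- An exponent of even degree has an even number of odd entries, and it is square-free exactly
when these exhaust the degree. -/
theorem card_odd_of_sum_eq {n k : ℕ} {α : Fin n → ℕ} (h : ∑ i, α i = 2 * k) :
    ∃ e ≤ k, #{i | Odd (α i)} = 2 * e ∧ (e = k ↔ ∀ i, α i ≤ 1) := by
  have hle : ∀ i ∈ univ, (if Odd (α i) then 1 else 0) ≤ α i := by
    intro i _
    split_ifs with ho
    · exact ho.pos
    · exact Nat.zero_le _
  have hcard : #{i | Odd (α i)} = ∑ i, if Odd (α i) then 1 else 0 := Finset.card_filter _ _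
  have heven : Even #{i | Odd (α i)} := by
    rw [← Nat.not_odd_iff_even, ← Finset.odd_sum_iff_odd_card_odd, h]
    simp
  obtain ⟨e, he⟩ := heven
  refine ⟨e, ?_, by omega, ?_⟩
  · have := Finset.sum_le_sum hle
    omega
  · have hiff := Finset.sum_eq_sum_iff_of_le hle
    have h1 : e = k ↔ ∑ i, (if Odd (α i) then 1 else 0) = ∑ i, α i := by omega
    rw [h1, hiff]
    refine forall_congr' fun i => ?_
    simp only [mem_univ, forall_const]
    split_ifs with ho
    · have := ho.pos
      omega
    · rw [Nat.not_odd_iff_even] at ho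
      obtain ⟨r, hr⟩ := ho
      omega

theorem card_filter_card_lt (n k : ℕ) :
    #{I : Finset (Fin n) | #I < k} = ∑ r ∈ range k, n.choose r := by
  rw [Finset.card_eq_sum_card_fiberwise (f := card) (t := range k) (by intro I; simp)]
  refine Finset.sum_congr rfl fun r hr => ?_
  have : ({I ∈ ({I : Finset (Fin n) | #I < k} : Finset _) | #I = r}) = powersetCard r univ := by
    ext I
    simp only [mem_filter, mem_univ, true_and, mem_powersetCard, subset_univ]
    have := mem_range.1 hr
    omega
  rw [this, card_powersetCard, card_univ, Fintype.card_fin]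

theorem isPowerSum_esymm {n k : ℕ} (hk : 0 < k) :
    IsPowerSum (2 * k) (esymm (Fin n) ℂ (2 * k)) (∑ r ∈ range (k + 1), n.choose r) := by
  set N : Finset (Finset (Fin n)) := {I | #I < k + 1} with hN
  have hmem := prod_card_sub_mem_span (n := n) k fun i => 2 * (i : ℂ)
  have hset : {I : Finset (Fin n) | #I ≤ k} = (N : Set (Finset (Fin n))) := by
    ext I
    simp [hN]
  rw [hset, Submodule.mem_span_image_finset_iff_exists_fun'] at hmem
  obtain ⟨c, hc⟩ := hmem
  replace hc : ∀ J : Finset (Fin n), ∑ I ∈ N, c I * signChar I J =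
      ∏ i ∈ range k, ((#J : ℂ) - 2 * (i : ℂ)) := by
    intro J
    simpa using congrFun hc J
  set P : ℂ := ∏ i ∈ range k, ((2 * k : ℂ) - 2 * (i : ℂ)) with hP
  have hP0 : P ≠ 0 := by
    refine Finset.prod_ne_zero_iff.2 fun i hi h0 => ?_
    have h1 : (k : ℂ) = i := by linear_combination h0 / 2
    exact (mem_range.1 hi).ne' (Nat.cast_injective h1)
  have hf0 : ((2 * k).factorial : ℂ) ≠ 0 := Nat.cast_ne_zero.2 (Nat.factorial_ne_zero _)
  have hroot : ∀ I, ∃ z : ℂ, z ^ (2 * k) = c I / (P * (2 * k).factorial) := fun I =>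
    IsAlgClosed.exists_pow_nat_eq _ (by omega)
  choose z hz using hroot
  have hesymm : esymm (Fin n) ℂ (2 * k) =
      ∑ I : N, (∑ i, (z I * if i ∈ I.1 then -1 else 1) • X i) ^ (2 * k) := by
    rw [esymm_eq_sum_pow_iff]
    intro α hα
    obtain ⟨e, hek, hcard, he⟩ := card_odd_of_sum_eq hα
    have hterm : ∀ I : N, ∏ i, (z I * if i ∈ I.1 then (-1 : ℂ) else 1) ^ α i =
        c I * signChar I.1 {i | Odd (α i)} / (P * (2 * k).factorial) := by
      intro I
      simp only [mul_pow]
      rw [Finset.prod_mul_distrib, Finset.prod_pow_eq_pow_sum, hα, hz, prod_pow_eq_signChar]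
      ring
    rw [Finset.sum_congr rfl fun I _ => hterm I, ← Finset.sum_div,
      Finset.sum_coe_sort N fun I => c I * signChar I {i | Odd (α i)}, hc, hcard]
    split_ifs with h1
    · rw [he.2 h1]
      push_cast
      rw [← hP]
      field_simp
    · have hlt : e < k := lt_of_le_of_ne hek fun h => h1 (he.1 h)
      rw [Finset.prod_eq_zero (mem_range.2 hlt) (by push_cast; ring)]
      simp
  have hcardN : Fintype.card N = ∑ r ∈ range (k + 1), n.choose r := by
    rw [Fintype.card_coe, card_filter_card_lt]
  let eqv : Fin (∑ r ∈ range (k + 1), n.choose r) ≃ N := (Fintype.equivFinOfCardEq hcardN).symm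
  refine ⟨fun j => ∑ i, (z (eqv j) * if i ∈ (eqv j).1 then -1 else 1) • X i,
    fun j => isHomogeneous_sum_smul_X _, ?_⟩
  rw [hesymm]
  exact (eqv.sum_comp fun I : N =>
    (∑ i, (z I * if i ∈ I.1 then (-1 : ℂ) else 1) • (X i : MvPolynomial (Fin n) ℂ)) ^ (2 * k)).symm

/-! ### The disjointness matrix -/

/-- Coefficients of a right inverse of the matrix with rows the `#S`-subsets of `Fin m`, columns the
`l`-subsets, and entry `1` at disjoint pairs, `0` at the others. -/
noncomputable def disjointnessInverse {m : ℕ} (l : ℕ) (S T : Finset (Fin m)) : ℂ :=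
  ∑ R ∈ S.powerset with R ⊆ T, (-1) ^ #R / ((m - #S - #R).choose (l - #R) : ℂ)

/-- Summing over `T` first, each `R ⊆ S \ S'` contributes `(-1) ^ #R`, because the number of `T` with
`R ⊆ T ⊆ S'ᶜ` depends only on `#R`; the alternating sum then detects `S \ S' = ∅`. -/
theorem sum_disjointnessInverse {m l : ℕ} {S S' : Finset (Fin m)} (hSS' : #S = #S') (hl : #S ≤ l)
    (hm : #S + l ≤ m) :
    ∑ T ∈ powersetCard l S'ᶜ, disjointnessInverse l S T = if S = S' then 1 else 0 := by
  simp only [disjointnessInverse, Finset.sum_filter]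
  rw [Finset.sum_comm]
  have hR : ∀ R ∈ S.powerset, (∑ T ∈ powersetCard l S'ᶜ, if R ⊆ T then
      (-1) ^ #R / ((m - #S - #R).choose (l - #R) : ℂ) else 0) =
        if R ⊆ S'ᶜ then (-1) ^ #R else 0 := by
    intro R hR
    have hRS := card_le_card (mem_powerset.1 hR)
    rw [← Finset.sum_filter, Finset.sum_const, nsmul_eq_mul]
    split_ifs with h
    · rw [card_filter_powersetCard_subset _ _ _ h (hRS.trans hl), card_compl, Fintype.card_fin,
        ← hSS']
      have : ((m - #S - #R).choose (l - #R) : ℂ) ≠ 0 :=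
        Nat.cast_ne_zero.2 (Nat.choose_pos (by omega)).ne'
      field_simp
    · rw [Finset.filter_false_of_mem]
      · simp
      · intro T hT hRT
        exact h (hRT.trans (mem_powersetCard.1 hT).1)
  rw [Finset.sum_congr rfl hR, ← Finset.sum_filter]
  have hfilter : {R ∈ S.powerset | R ⊆ S'ᶜ} = (S \ S').powerset := by
    ext R
    simp only [mem_filter, mem_powerset, sdiff_eq_inter_compl, subset_inter_iff]
  have hsign := sum_powerset_neg_one_pow_card (x := S \ S')
  have hsign' : ∑ R ∈ (S \ S').powerset, (-1 : ℂ) ^ #R = if S \ S' = ∅ then 1 else 0 := by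
    exact_mod_cast congrArg (Int.cast : ℤ → ℂ) hsign
  rw [hfilter, hsign']
  refine if_congr ?_ rfl rfl
  rw [sdiff_eq_empty_iff_subset]
  exact ⟨fun h => eq_of_subset_of_card_le h hSS'.ge, fun h => h.subset⟩

/-! ### The lower bound -/

/-- Vectors are linearly independent if some functionals pair with them in a triangular matrix with
nonzero diagonal, where `δ` orders the indices into blocks. -/
theorem linearIndependent_of_triangular_pairing {ι K V : Type*} [Field K] [AddCommGroup V]
    [Module K V] [Fintype ι] (v : ι → V) (φ : ι → V →ₗ[K] K) (δ : ι → ℕ)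
    (hdiag : ∀ i, φ i (v i) ≠ 0) (htri : ∀ i j, i ≠ j → δ j ≤ δ i → φ i (v j) = 0) :
    LinearIndependent K v := by
  classical
  rw [Fintype.linearIndependent_iff]
  intro g hg
  by_contra! hne
  obtain ⟨i₁, hi₁⟩ := hne
  obtain ⟨i, hi, hmax⟩ := Finset.exists_max_image ({i | g i ≠ 0} : Finset ι) δ ⟨i₁, by simpa⟩
  have h0 := congrArg (φ i) hg
  rw [map_sum, map_zero, Finset.sum_eq_single i] at h0
  · rw [map_smul, smul_eq_mul, mul_eq_zero] at h0
    exact h0.elim (mem_filter.1 hi).2 (hdiag i)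
  · intro j _ hj
    rw [map_smul, smul_eq_mul, mul_eq_zero, or_iff_not_imp_left]
    exact fun hgj => htri i j (Ne.symm hj) (hmax j (by simpa using hgj))
  · simp

/-- A weighted quadrature rule with `s` nodes `b i` that annihilates every product of two square-free
monomials of total degree below `2 * k`, except that it takes the constant value `c ≠ 0` on the
square-free monomials of degree `2 * k - 1`, needs many nodes: the monomials of degree below `k`
and dual forms `g_S` of degree `2 * k - 1 - #S` are independent on the nodes. -/
theorem two_mul_card_le_of_moments {m k s : ℕ} (hk : 2 * k ≤ m + 1) (w : Fin s → ℂ)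
    (b : Fin s → Fin m → ℂ) {c : ℂ} (hc : c ≠ 0)
    (h : ∀ S T : Finset (Fin m), #S + #T < 2 * k →
      ∑ i, w i * ((∏ x ∈ S, b i x) * ∏ x ∈ T, b i x) =
        if Disjoint S T ∧ #S + #T + 1 = 2 * k then c else 0) :
    2 * #{S : Finset (Fin m) | #S < k} ≤ s := by
  set A : Finset (Finset (Fin m)) := {S | #S < k} with hA
  have hlt : ∀ S : A, #S.1 < k := fun S => (mem_filter.1 S.2).2
  let mon : Finset (Fin m) → Fin s → ℂ := fun S i => ∏ x ∈ S, b i x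
  let dual : Finset (Fin m) → Fin s → ℂ := fun S =>
    ∑ T ∈ powersetCard (2 * k - 1 - #S) univ, disjointnessInverse (2 * k - 1 - #S) S T • mon T
  -- The functional `f ↦ ∑ i, w i * (f i * g i)`.
  let pair : (Fin s → ℂ) → (Fin s → ℂ) →ₗ[ℂ] ℂ := fun g =>
    ∑ i, (w i * g i) • LinearMap.proj i
  have pair_apply : ∀ g f, pair g f = ∑ i, w i * (f i * g i) := by
    intro g f
    simp only [pair, LinearMap.coe_sum, Finset.sum_apply, LinearMap.smul_apply,
      LinearMap.proj_apply, smul_eq_mul]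
    exact Finset.sum_congr rfl fun i _ => by ring
  have pair_comm : ∀ g f, pair g f = pair f g := by
    intro g f
    simp only [pair_apply, mul_comm]
  have pair_mon : ∀ S T : Finset (Fin m), #S + #T < 2 * k →
      pair (mon T) (mon S) = if Disjoint S T ∧ #S + #T + 1 = 2 * k then c else 0 := by
    intro S T hST
    rw [pair_apply, ← h S T hST]
  have pair_dual : ∀ S T : Finset (Fin m), #S < k → #T ≤ #S →
      pair (mon T) (dual S) = if S = T then c else 0 := by
    intro S T hS hTS
    simp only [dual, map_sum, map_smul, smul_eq_mul]
    have hterm : ∀ U ∈ powersetCard (2 * k - 1 - #S) (univ : Finset (Fin m)),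
        disjointnessInverse (2 * k - 1 - #S) S U * pair (mon T) (mon U) =
          if Disjoint U T ∧ #T = #S then disjointnessInverse (2 * k - 1 - #S) S U * c else 0 := by
      intro U hU
      have hcU := (mem_powersetCard.1 hU).2
      rw [pair_mon U T (by omega), mul_ite, mul_zero]
      refine if_congr (and_congr_right fun _ => ?_) rfl rfl
      omega
    rw [Finset.sum_congr rfl hterm]
    by_cases hcard : #T = #S
    · have hfil : {U ∈ powersetCard (2 * k - 1 - #S) (univ : Finset (Fin m)) | Disjoint U T} =
          powersetCard (2 * k - 1 - #S) Tᶜ := by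
        ext U
        simp only [mem_filter, mem_powersetCard, subset_univ, true_and, subset_compl_iff_disjoint_right]
        tauto
      simp only [hcard, and_true]
      rw [← Finset.sum_filter, hfil, ← Finset.sum_mul,
        sum_disjointnessInverse hcard.symm (by omega) (by omega), ite_mul, one_mul, zero_mul]
    · have hne : S ≠ T := fun h => hcard (by rw [h])
      simp [hcard, hne]
  have hli : LinearIndependent ℂ (Sum.elim (fun S : A => mon S) fun S : A => dual S) := by
    refine linearIndependent_of_triangular_pairing _
      (Sum.elim (fun S : A => pair (dual S)) fun S : A => pair (mon S))
      (Sum.elim (fun S : A => #S.1) fun S : A => 2 * k - 1 - #S.1) ?_ ?_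
    · rintro (S | S)
      · simpa [pair_comm (dual S), pair_dual S S (hlt S) le_rfl] using hc
      · simpa [pair_dual S S (hlt S) le_rfl] using hc
    · rintro (S | S) (T | T) hne hle <;> have hS := hlt S <;> have hT := hlt T <;>
        simp only [Sum.elim_inl, Sum.elim_inr] at hle ⊢
      · rw [pair_comm, pair_dual S T hS hle, if_neg]
        exact fun h => hne (by rw [Subtype.ext h])
      · omega
      · rw [pair_mon T S (by omega), if_neg]
        omega
      · rw [pair_dual T S hT (by omega), if_neg]
        exact fun h => hne (by rw [Subtype.ext h])
  have := hli.fintype_card_le_finrank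
  simp only [Fintype.card_sum, Fintype.card_coe, Module.finrank_fin_fun] at this
  omega

/-- Dehomogenizing with respect to the first variable turns a power sum representation into a
quadrature rule; the linear forms without `x_1` receive weight zero, so their junk quotients
`x / 0` do no harm. -/
theorem two_mul_card_le_of_isPowerSum {m k s : ℕ} (hk : 2 * k ≤ m + 1)
    (h : IsPowerSum (2 * k) (esymm (Fin (m + 1)) ℂ (2 * k)) s) :
    2 * #{S : Finset (Fin m) | #S < k} ≤ s := by
  obtain ⟨L, hL, hF⟩ := h
  choose a ha using fun i => exists_eq_sum_smul_X (hL i)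
  simp only [← ha] at hF
  rw [esymm_eq_sum_pow_iff] at hF
  have hf0 : ((2 * k).factorial : ℂ) ≠ 0 := Nat.cast_ne_zero.2 (Nat.factorial_ne_zero _)
  refine two_mul_card_le_of_moments hk (fun i => a i 0 ^ (2 * k))
    (fun i x => a i x.succ / a i 0) (inv_ne_zero hf0) fun S T hST => ?_
  let β : Fin m → ℕ := fun x => (if x ∈ S then 1 else 0) + if x ∈ T then 1 else 0
  have hβ : ∑ x, β x = #S + #T := by simp [β, Finset.sum_add_distrib]
  let α : Fin (m + 1) →₀ ℕ :=
    Finsupp.equivFunOnFinite.symm (Fin.cons (2 * k - (#S + #T)) β)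
  have hα0 : α 0 = 2 * k - (#S + #T) := rfl
  have hαs : ∀ x : Fin m, α x.succ = β x := fun x => rfl
  have hsum : ∑ i, α i = 2 * k := by
    rw [Fin.sum_univ_succ, hα0]
    simp only [hαs, hβ]
    omega
  have hmom := hF α hsum
  have hterm : ∀ i, a i 0 ^ (2 * k) * ((∏ x ∈ S, a i x.succ / a i 0) * ∏ x ∈ T, a i x.succ / a i 0) =
      ∏ j, a i j ^ α j := by
    intro i
    rw [Fin.prod_univ_succ, hα0]
    simp only [hαs, β, pow_add, Finset.prod_mul_distrib, pow_ite, pow_one, pow_zero,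
      Finset.prod_ite_mem, univ_inter, Finset.prod_div_distrib, Finset.prod_const]
    by_cases h0 : a i 0 = 0
    · simp [h0, show k ≠ 0 by omega, show 2 * k - (#S + #T) ≠ 0 by omega]
    · have : a i 0 ^ (2 * k) = a i 0 ^ (2 * k - (#S + #T)) * a i 0 ^ #S * a i 0 ^ #T := by
        rw [← pow_add, ← pow_add]
        congr 1
        omega
      rw [this]
      field_simp
  have hiff : (∀ i, α i ≤ 1) ↔ Disjoint S T ∧ #S + #T + 1 = 2 * k := by
    rw [Fin.forall_fin_succ, hα0, and_comm]
    simp only [hαs, β]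
    refine and_congr ?_ (by omega)
    rw [Finset.disjoint_left]
    refine forall_congr' fun x => ?_
    split_ifs <;> simp_all
  simp only [hterm]
  rw [← if_congr hiff rfl rfl]
  refine mul_left_cancel₀ hf0 (hmom.trans ?_)
  split_ifs <;> simp [hf0]

theorem sum_choose_sub_eq (m k : ℕ) :
    ∑ r ∈ range (k + 1), ((m + 1).choose r : ℤ) - (m.choose k : ℤ) =
      2 * ∑ r ∈ range k, (m.choose r : ℤ) := by
  induction k with
  | zero => simp
  | succ k ih =>
    rw [Finset.sum_range_succ _ (k + 1), Finset.sum_range_succ (fun r => (m.choose r : ℤ)) k, Nat.choose_succ_succ']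
    push_cast
    linarith

theorem corollary5 (n d : ℕ) (hn : 1 ≤ n) (hdn : d ≤ n) (hd : Even d) :
    (∃ s : ℕ, IsPowerSum d (MvPolynomial.esymm (Fin n) ℂ d) s) ∧
    (∑ r ∈ Finset.range (d / 2 + 1), (n.choose r : ℤ)) - ((n - 1).choose (d / 2) : ℤ)
        ≤ (symmetricRank d (MvPolynomial.esymm (Fin n) ℂ d) : ℤ) ∧
    symmetricRank d (MvPolynomial.esymm (Fin n) ℂ d)
        ≤ ∑ r ∈ Finset.range (d / 2 + 1), n.choose r := by
  obtain ⟨k, rfl⟩ := hd.exists_two_nsmul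
  obtain ⟨m, rfl⟩ := Nat.exists_eq_add_of_le' hn
  simp only [smul_eq_mul, Nat.add_sub_cancel] at *
  rw [Nat.mul_div_cancel_left k two_pos]
  have hup : IsPowerSum (2 * k) (esymm (Fin (m + 1)) ℂ (2 * k))
      (∑ r ∈ range (k + 1), (m + 1).choose r) := by
    rcases Nat.eq_zero_or_pos k with rfl | hk
    · -- In degree zero the single form `0` works, as `0 ^ 0 = 1`.
      rw [show ∑ r ∈ range (0 + 1), (m + 1).choose r = 1 by simp]
      exact ⟨fun _ => 0, fun _ => isHomogeneous_zero _ _ _, by simp [esymm_zero]⟩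
    · exact isPowerSum_esymm hk
  refine ⟨⟨_, hup⟩, ?_, Nat.sInf_le hup⟩
  have hrank : IsPowerSum (2 * k) (esymm (Fin (m + 1)) ℂ (2 * k))
      (symmetricRank (2 * k) (esymm (Fin (m + 1)) ℂ (2 * k))) :=
    Nat.sInf_mem (s := {s | IsPowerSum (2 * k) (esymm (Fin (m + 1)) ℂ (2 * k)) s}) ⟨_, hup⟩
  have hlow := two_mul_card_le_of_isPowerSum hdn hrank
  rw [card_filter_card_lt] at hlow
  rw [sum_choose_sub_eq]
  exact_mod_cast hlow
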